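/- A metric space $(X,d_X)$ is called a CAT(0) space if there is a map $\mathfrak B$ from the finitely supported probability measures on $X$ to $X$ such that $$d_X(x,\mathfrak B(\mu))^2+\int_X d_X(\mathfrak B(\mu),y)^2\,d\mu(y)\le \int_X d_X(x,y)^2\,d\mu(y)$$ for every $x\in X$ and every probability measure $\mu$ supported on at most two points of $X$ (completeness is not required). For $n\in\{1,2,\ldots\}$, a matrix $A=(a_{ij})\in M_n(\mathbb R)$ with nonnegative entries and a metric space $(X,d_X)$, let $\gamma_+(A,d_X^2)\in[0,\infty]$ be the infimum of those $\gamma\in(0,\infty]$ for which all $x_1,\ldots,x_n,y_1,\ldots,y_n\in X$ satisfy $$\frac1{n^2}\sum_{i=1}^n\sum_{j=1}^n d_X(x_i,y_j)^2\le \frac{\gamma}{n}\sum_{i=1}^n\sum_{j=1}^n a_{ij}\,d_X(x_i,y_j)^2$$ (so $\gamma_+(A,d_X^2)=\infty$ if no finite $\gamma$ works). There is a universal constant $C\in(0,\infty)$ such that for every CAT(0) space $(X,d_X)$, all integers $n,t\ge 1$ and every symmetric stochastic matrix $A\in M_n(\mathbb R)$, $$\gamma_+\Big(\frac1t\sum_{s=1}^t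 A^s,\,d_X^2\Big)\le C\max\Big\{1,\frac{\gamma_+(A,d_X^2)}{t}\Big\}.$$ -/

import Mathlib

open scoped ENNReal

/-- A metric space is CAT(0) if there is a map `B`, defined on finitely supported probability
measures, such that every `μ` supported on at most two points and every `x : X` satisfy
`d(x, B μ)² + ∫ d(B μ, y)² dμ(y) ≤ ∫ d(x, y)² dμ(y)`.
Here `Convexity.StdSimplex ℝ X` is the set of finitely supported probability measures on `X`,
and `μ.weights` is the finitely supported function `y ↦ μ {y}`. Completeness is not required. -/
def IsCAT0 (X : Type*) [MetricSpace X] : Prop :=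
  ∃ B : Convexity.StdSimplex ℝ X → X, ∀ μ : Convexity.StdSimplex ℝ X, μ.weights.support.card ≤ 2 →
    ∀ x : X, dist x (B μ) ^ 2 + ∑ y ∈ μ.weights.support, μ.weights y * dist (B μ) y ^ 2 ≤
      ∑ y ∈ μ.weights.support, μ.weights y * dist x y ^ 2

/-- The nonlinear absolute spectral gap parameter `γ₊(A, d_X^p)`: the infimum over those
`γ ∈ (0, ∞]` such that all `x₁, …, xₙ, y₁, …, yₙ ∈ X` satisfy
`(1 / n²) ∑ᵢⱼ d(xᵢ, yⱼ)^p ≤ (γ / n) ∑ᵢⱼ aᵢⱼ d(xᵢ, yⱼ)^p`.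
It is `∞` when no finite `γ` works. -/
noncomputable def gammaPlus {n : ℕ} (A : Matrix (Fin n) (Fin n) ℝ) (X : Type*) [MetricSpace X]
    (p : ℝ) : ℝ≥0∞ :=
  sInf {γ : ℝ≥0∞ | 0 < γ ∧ ∀ x y : Fin n → X,
    ENNReal.ofReal (1 / (n : ℝ) ^ 2 * ∑ i, ∑ j, dist (x i) (y j) ^ p) ≤
      γ / n * ENNReal.ofReal (∑ i, ∑ j, A i j * dist (x i) (y j) ^ p)}

/-- The Cesàro average `(1 / t) ∑_{s = 1}^t A^s`. -/
noncomputable def cesaroAverage {n : ℕ} (A : Matrix (Fin n) (Fin n) ℝ) (t : ℕ) :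
    Matrix (Fin n) (Fin n) ℝ :=
  (1 / (t : ℝ)) • ∑ s ∈ Finset.Icc 1 t, A ^ s

/-!
In a CAT(0) space the nonlinear heat flow attached to a stochastic matrix dissipates energy much
as the linear one does. Every finite weighted family of points has a barycenter `b` in the
completion, with `d(z, b)² + ∑ wⱼ d(b, pⱼ)² ≤ ∑ wⱼ d(z, pⱼ)²` for all `z`
(`IsCAT0.exists_barycenter`). Let `(P f) i` be the barycenter of the points `f j` with weights
`A i j`, and write `E_M(x, y) = ∑ᵢⱼ Mᵢⱼ d(xᵢ, yⱼ)²`. Iterating the barycenter inequality gives,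
for all configurations `z` and `y` (`sqEnergy_iterate`),

`∑ᵢ d(zᵢ, (Pˢ y)ᵢ)² + ∑_{r < s} E_A(P^{r+1} y, Pʳ y) ≤ E_{Aˢ}(z, y)`.

Given `x` and `y`, the Poincaré inequality for `A` is applied to `u = P^{2a+1} y` and `v = P^{2a} y`.
Taking `z = x` shows that `u` is within `E_{A^{2a+1}}(x, y)` of `x`. Taking `z = y` shows that `v` is
within `E_{A^{2a}}(y, y) ≤ 4 E_{Aᵃ}(x, y)` of `y` (`sqEnergy_mul_self_le`); the even exponent is what
allows a return to `y` to be compared with energies between `x` and `y`. The term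
`E_A(u, v)` is one of the dissipated energies, whose sum over `r < s` is at most `E_{Aˢ}(x, y)` for
every `s`; averaging over `t / 2 ≤ s ≤ t` and over about `t / 4` values of `a`
(`le_of_forall_dissipation`) gains the factor `1 / t` and leaves only the energy of the Cesàro
average. Completeness is not needed since the Poincaré inequality extends to the completion by
density.
-/

open Filter Topology UniformSpace Finset

/-! ### Barycenters in the completion of a CAT(0) space -/

/-- The barycenter of the measure `(1 - l) δ_p + l δ_q` satisfies the usual CAT(0) comparison
inequality along the geodesic from `p` to `q`. -/
theorem IsCAT0.exists_geodesic_point {X : Type*} [MetricSpace X] (hX : IsCAT0 X) (p q : X) {l : ℝ}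
    (hl₀ : 0 ≤ l) (hl₁ : l ≤ 1) :
    ∃ m : X, ∀ z : X, dist z m ^ 2 + l * (1 - l) * dist p q ^ 2 ≤
      (1 - l) * dist z p ^ 2 + l * dist z q ^ 2 := by
  classical
  obtain ⟨B, hB⟩ := hX
  let μ : Convexity.StdSimplex ℝ X :=
    Convexity.StdSimplex.duple p q (sub_nonneg.2 hl₁) hl₀ (by ring)
  have hμ : μ.weights = Finsupp.single p (1 - l) + Finsupp.single q l := rfl
  have hsum (f : X → ℝ) : ∑ y ∈ μ.weights.support, μ.weights y * f y = (1 - l) * f p + l * f q := by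
    change μ.weights.sum (fun y r => r * f y) = _
    rw [hμ, Finsupp.sum_add_index' (by simp) (by intros; ring),
      Finsupp.sum_single_index (by simp), Finsupp.sum_single_index (by simp)]
  have hcard : μ.weights.support.card ≤ 2 := by
    refine (card_le_card (t := {p, q}) ?_).trans card_le_two
    intro y hy
    by_contra h
    simp only [mem_insert, mem_singleton, not_or] at h
    simp [hμ, Ne.symm h.1, Ne.symm h.2] at hy
  refine ⟨B μ, fun z => ?_⟩
  have h := hB μ hcard z
  rw [hsum, hsum] at h
  have h₁ : dist p q ^ 2 ≤ (dist (B μ) p + dist (B μ) q) ^ 2 :=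
    pow_le_pow_left₀ dist_nonneg (dist_triangle_left _ _ _) 2
  have h₂ := mul_le_mul_of_nonneg_left h₁ (mul_nonneg hl₀ (sub_nonneg.2 hl₁))
  nlinarith [sq_nonneg ((1 - l) * dist (B μ) p - l * dist (B μ) q)]

/-- Approximate minimisers of the variance functional `G z = ∑ j, w j * dist z (p j) ^ 2` form a
Cauchy sequence by uniform convexity; their limit is the barycenter, and comparing `G` along the
geodesic from the barycenter towards `z` gives the variance inequality. -/
theorem IsCAT0.exists_barycenter {X : Type*} [MetricSpace X] [Nonempty X] (hX : IsCAT0 X)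
    {ι : Type*} [Fintype ι] {w : ι → ℝ} (hw₀ : ∀ j, 0 ≤ w j) (hw₁ : ∑ j, w j = 1)
    (p : ι → Completion X) :
    ∃ b : Completion X, ∀ z : Completion X,
      dist z b ^ 2 + ∑ j, w j * dist b (p j) ^ 2 ≤ ∑ j, w j * dist z (p j) ^ 2 := by
  set G : Completion X → ℝ := fun z => ∑ j, w j * dist z (p j) ^ 2 with hG
  have hGc : Continuous G := by fun_prop
  have hG₀ (z) : 0 ≤ G z := sum_nonneg fun j _ => mul_nonneg (hw₀ j) (sq_nonneg _)
  have hconv (x y : X) (l : ℝ) (hl₀ : 0 ≤ l) (hl₁ : l ≤ 1) :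
      ∃ m : X, G m + l * (1 - l) * dist x y ^ 2 ≤ (1 - l) * G x + l * G y := by
    obtain ⟨m, hm⟩ := hX.exists_geodesic_point x y hl₀ hl₁
    have hm' (z : Completion X) : dist z m ^ 2 + l * (1 - l) * dist x y ^ 2 ≤
        (1 - l) * dist z x ^ 2 + l * dist z y ^ 2 := by
      induction z using Completion.induction_on with
      | hp => exact isClosed_le (by fun_prop) (by fun_prop)
      | ih z => simpa [Completion.dist_eq] using hm z
    refine ⟨m, ?_⟩
    have h := sum_le_sum fun j (_ : j ∈ univ) => mul_le_mul_of_nonneg_left (hm' (p j)) (hw₀ j)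
    simp only [mul_add, sum_add_distrib, ← sum_mul, hw₁, one_mul] at h
    simp only [hG, mul_sum]
    simp only [dist_comm (p _), mul_left_comm (w _)] at h
    exact h
  have hbdd : BddBelow (Set.range fun x : X => G x) := ⟨0, by rintro _ ⟨x, rfl⟩; exact hG₀ _⟩
  set c := ⨅ x : X, G x with hc
  have hcle (x : X) : c ≤ G x := ciInf_le hbdd x
  have hex (k : ℕ) : ∃ x : X, G x < c + 1 / ((k : ℝ) + 1) :=
    exists_lt_of_ciInf_lt (lt_add_of_pos_right c (by positivity))
  choose b hb using hex
  have key (k : ℕ) (x : X) (l : ℝ) (hl₀ : 0 < l) (hl₁ : l ≤ 1) :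
      G (b k) + (1 - l) * dist x (b k) ^ 2 ≤ G x + 1 / ((k : ℝ) + 1) / l := by
    -- `c ≤ G m` at the point `m` dividing the geodesic from `b k` to `x` in proportion `l`.
    obtain ⟨m, hm⟩ := hconv (b k) x l hl₀.le hl₁
    have h₁ := hcle m
    have h₂ := hb k
    rw [dist_comm] at hm
    refine le_of_mul_le_mul_left ?_ hl₀
    rw [mul_add l (G x), mul_div_cancel₀ _ hl₀.ne']
    linarith
  have hcau : CauchySeq fun k => (b k : Completion X) := by
    refine cauchySeq_of_le_tendsto_0 (fun N : ℕ => √(6 * (1 / ((N : ℝ) + 1)))) ?_ ?_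
    · intro k k' N hk hk'
      rw [Completion.dist_eq]
      refine Real.le_sqrt_of_sq_le ?_
      have h := key k' (b k) (1 / 2) (by norm_num) (by norm_num)
      have h₁ := hcle (b k')
      have h₂ := hb k
      have e₁ : 1 / ((k : ℝ) + 1) ≤ 1 / ((N : ℝ) + 1) := by gcongr
      have e₂ : 1 / ((k' : ℝ) + 1) ≤ 1 / ((N : ℝ) + 1) := by gcongr
      linarith
    · simpa using (tendsto_one_div_add_atTop_nhds_zero_nat (𝕜 := ℝ)).const_mul 6 |>.sqrt
  obtain ⟨β, hβ⟩ := cauchySeq_tendsto_of_complete hcau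
  have hlim (x : X) (l : ℝ) (hl₀ : 0 < l) (hl₁ : l ≤ 1) :
      G β + (1 - l) * dist (x : Completion X) β ^ 2 ≤ G x := by
    have t₁ : Tendsto (fun k => G (b k) + (1 - l) * dist (x : Completion X) (b k) ^ 2) atTop
        (𝓝 (G β + (1 - l) * dist (x : Completion X) β ^ 2)) :=
      ((hGc.tendsto β).comp hβ).add (((tendsto_const_nhds.dist hβ).pow 2).const_mul _)
    have t₂ : Tendsto (fun k : ℕ => G x + 1 / ((k : ℝ) + 1) / l) atTop (𝓝 (G x)) := by
      simpa using ((tendsto_one_div_add_atTop_nhds_zero_nat (𝕜 := ℝ)).div_const l).const_add (G x)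
    exact le_of_tendsto_of_tendsto' t₁ t₂ fun k => by
      simpa [Completion.dist_eq] using key k x l hl₀ hl₁
  -- Extend from `X` to its completion by density, then let `l → 0`.
  refine ⟨β, fun z => ?_⟩
  change dist z β ^ 2 + G β ≤ G z
  induction z using Completion.induction_on with
  | hp => exact isClosed_le (by fun_prop) hGc
  | ih x =>
    have t : Tendsto (fun l : ℝ => G β + (1 - l) * dist (x : Completion X) β ^ 2) (𝓝[>] 0)
        (𝓝 (G β + (1 - 0) * dist (x : Completion X) β ^ 2)) :=
      (Continuous.tendsto (by fun_prop) 0).mono_left nhdsWithin_le_nhds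
    have := le_of_tendsto t (by
      filter_upwards [Ioo_mem_nhdsGT (zero_lt_one (α := ℝ))] with l hl using hlim x l hl.1 hl.2.le)
    linarith

/-! ### The quadratic energy and its dissipation under barycentric averaging -/

section Energy

variable {Y : Type*} [MetricSpace Y] {ι : Type*} [Fintype ι]

/-- The quadratic energy `∑ i j, M i j * d(x i, y j)²` of two point configurations with respect to
the weight matrix `M`. -/
def sqEnergy (M : Matrix ι ι ℝ) (x y : ι → Y) : ℝ :=
  ∑ i, ∑ j, M i j * dist (x i) (y j) ^ 2

theorem sqEnergy_nonneg {M : Matrix ι ι ℝ} (hM : ∀ i j, 0 ≤ M i j) (x y : ι → Y) :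
    0 ≤ sqEnergy M x y :=
  sum_nonneg fun i _ => sum_nonneg fun j _ => mul_nonneg (hM i j) (sq_nonneg _)

theorem sqEnergy_one [DecidableEq ι] (x y : ι → Y) :
    sqEnergy 1 x y = ∑ i, dist (x i) (y i) ^ 2 := by
  simp [sqEnergy, Matrix.one_apply]

/-- One step of barycentric averaging `f ↦ Pf`. Column-stochasticity of `M` makes the dissipated
term independent of `M`. -/
theorem sqEnergy_step [DecidableEq ι] {M A : Matrix ι ι ℝ} (hM : M ∈ Matrix.colStochastic ℝ ι)
    {f Pf : ι → Y}
    (hP : ∀ i z, dist z (Pf i) ^ 2 + ∑ j, A i j * dist (Pf i) (f j) ^ 2 ≤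
      ∑ j, A i j * dist z (f j) ^ 2) (z : ι → Y) :
    sqEnergy M z Pf + sqEnergy A Pf f ≤ sqEnergy (M * A) z f := by
  have h₁ : sqEnergy A Pf f = ∑ i, ∑ j, M i j * ∑ k, A j k * dist (Pf j) (f k) ^ 2 := by
    rw [sum_comm]
    simp only [← sum_mul, Matrix.sum_col_of_mem_colStochastic hM, one_mul, sqEnergy]
  have h₂ : sqEnergy (M * A) z f = ∑ i, ∑ j, M i j * ∑ k, A j k * dist (z i) (f k) ^ 2 := by
    refine sum_congr rfl fun i _ => ?_
    simp only [Matrix.mul_apply, sum_mul, mul_sum, mul_assoc]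
    exact sum_comm
  rw [h₁, h₂, sqEnergy, ← sum_add_distrib]
  refine sum_le_sum fun i _ => ?_
  rw [← sum_add_distrib]
  refine sum_le_sum fun j _ => ?_
  rw [← mul_add]
  exact mul_le_mul_of_nonneg_left (hP j (z i)) (Matrix.nonneg_of_mem_colStochastic hM)

/-- Telescoped energy dissipation: along the iterates of the averaging operator `P` attached to
`A`, the total energy of consecutive iterates is controlled by the energy of the matrix power. -/
theorem sqEnergy_iterate [DecidableEq ι] {A : Matrix ι ι ℝ} (hA : A ∈ Matrix.colStochastic ℝ ι)
    {P : (ι → Y) → ι → Y}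
    (hP : ∀ f i z, dist z (P f i) ^ 2 + ∑ j, A i j * dist (P f i) (f j) ^ 2 ≤
      ∑ j, A i j * dist z (f j) ^ 2) (z f : ι → Y) (s : ℕ) {M : Matrix ι ι ℝ}
    (hM : M ∈ Matrix.colStochastic ℝ ι) :
    sqEnergy M z (P^[s] f) + ∑ r ∈ range s, sqEnergy A (P^[r + 1] f) (P^[r] f) ≤
      sqEnergy (M * A ^ s) z f := by
  induction s generalizing M with
  | zero => simp
  | succ s ih =>
    have h₁ := sqEnergy_step hM (hP (P^[s] f)) z
    have h₂ := ih (mul_mem hM hA)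
    rw [sum_range_succ, pow_succ', ← mul_assoc, Function.iterate_succ_apply' P s f]
    linarith

/-- The walk `M * M` between two points of `y` is split at its middle time, where the point of `x`
with the same index serves as intermediate point in the triangle inequality. -/
theorem sqEnergy_mul_self_le [DecidableEq ι] {M : Matrix ι ι ℝ}
    (hM : M ∈ Matrix.rowStochastic ℝ ι) (hMs : M.IsSymm) (x y : ι → Y) :
    sqEnergy (M * M) y y ≤ 4 * sqEnergy M x y := by
  have h₀ (i j) : 0 ≤ M i j := Matrix.nonneg_of_mem_rowStochastic hM
  have hr (i) : ∑ j, M i j = 1 := Matrix.sum_row_of_mem_rowStochastic hM i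
  have hsymm (i j) : M i j = M j i := hMs.apply j i
  have hc (j) : ∑ i, M i j = 1 := by simp only [hsymm _ j, hr]
  have h₁ : sqEnergy (M * M) y y ≤ ∑ i, ∑ j, ∑ k, M i k * M k j *
      (2 * dist (x k) (y i) ^ 2 + 2 * dist (x k) (y j) ^ 2) := by
    simp only [sqEnergy, Matrix.mul_apply, sum_mul]
    refine sum_le_sum fun i _ => sum_le_sum fun j _ => sum_le_sum fun k _ => ?_
    refine mul_le_mul_of_nonneg_left ?_ (mul_nonneg (h₀ _ _) (h₀ _ _))
    have := pow_le_pow_left₀ dist_nonneg (dist_triangle_left (y i) (y j) (x k)) 2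
    nlinarith [sq_nonneg (dist (x k) (y i) - dist (x k) (y j))]
  have h₂ : ∑ i, ∑ j, ∑ k, M i k * M k j * (2 * dist (x k) (y i) ^ 2) = 2 * sqEnergy M x y := by
    simp only [sqEnergy, mul_sum]
    calc _ = ∑ i, ∑ k, (∑ j, M k j) * (M i k * (2 * dist (x k) (y i) ^ 2)) := by
          refine sum_congr rfl fun i _ => ?_
          rw [sum_comm]
          refine sum_congr rfl fun k _ => ?_
          rw [sum_mul]
          exact sum_congr rfl fun j _ => by ring
      _ = _ := by
          rw [sum_comm]
          refine sum_congr rfl fun k _ => sum_congr rfl fun i _ => ?_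
          rw [hr, hsymm i k]; ring
  have h₃ : ∑ i, ∑ j, ∑ k, M i k * M k j * (2 * dist (x k) (y j) ^ 2) = 2 * sqEnergy M x y := by
    simp only [sqEnergy, mul_sum]
    calc _ = ∑ j, ∑ k, (∑ i, M i k) * (M k j * (2 * dist (x k) (y j) ^ 2)) := by
          rw [sum_comm]
          refine sum_congr rfl fun j _ => ?_
          rw [sum_comm]
          refine sum_congr rfl fun k _ => ?_
          rw [sum_mul]
          exact sum_congr rfl fun i _ => by ring
      _ = _ := by
          rw [sum_comm]
          refine sum_congr rfl fun k _ => sum_congr rfl fun j _ => ?_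
          rw [hc]; ring
  simp only [mul_add, sum_add_distrib] at h₁ h₂ h₃
  linarith

theorem sum_sq_dist_le_of_approx (x y u v : ι → Y) :
    ∑ i, ∑ j, dist (x i) (y j) ^ 2 ≤
      3 * (Fintype.card ι * (∑ i, dist (x i) (u i) ^ 2 + ∑ j, dist (y j) (v j) ^ 2)
        + ∑ i, ∑ j, dist (u i) (v j) ^ 2) := by
  have h : ∑ i, ∑ j, dist (x i) (y j) ^ 2 ≤ ∑ i, ∑ j, (3 * dist (x i) (u i) ^ 2 +
      3 * dist (y j) (v j) ^ 2 + 3 * dist (u i) (v j) ^ 2) := by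
    refine sum_le_sum fun i _ => sum_le_sum fun j _ => ?_
    have h := dist_triangle4 (x i) (u i) (v j) (y j)
    rw [dist_comm (v j)] at h
    have := pow_le_pow_left₀ dist_nonneg h 2
    nlinarith [sq_nonneg (dist (x i) (u i) - dist (u i) (v j)),
      sq_nonneg (dist (x i) (u i) - dist (y j) (v j)),
      sq_nonneg (dist (u i) (v j) - dist (y j) (v j))]
  refine h.trans_eq ?_
  simp only [sum_add_distrib, sum_const, card_univ, nsmul_eq_mul, ← mul_sum]
  ring

end Energy

/-! ### Averaging over time -/

/-- Purely numerical averaging step. The bound for `T` is summed over the `⌈t/4⌉` smallest values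
of `a`; the dissipated energies `e (2 * a)` are all spent before time `(t + 1) / 2`, so their sum is
bounded by `ψ s` for each of the at least `t / 2` later times `s ≤ t`. -/
theorem le_of_forall_dissipation {t : ℕ} (ht : 1 ≤ t) {T K L : ℝ} (hK : 0 ≤ K) (hL : 0 ≤ L)
    {ψ φ e : ℕ → ℝ} (hψ : ∀ s, 0 ≤ ψ s) (he : ∀ r, 0 ≤ e r) (hT₀ : 0 ≤ T)
    (hT : ∀ a, T ≤ K * (ψ (2 * a + 1) + φ a) + L * e (2 * a))
    (hes : ∀ s, ∑ r ∈ range s, e r ≤ ψ s) (hφ₀ : φ 0 = 0) (hφ : ∀ a, φ a ≤ 4 * ψ a) :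
    T ≤ (20 * K + 8 * (L / t)) * (1 / t * ∑ s ∈ Icc 1 t, ψ s) := by
  set S := ∑ s ∈ Icc 1 t, ψ s with hS
  obtain ⟨m, hm⟩ : ∃ m, m = (t + 3) / 4 := ⟨_, rfl⟩
  have htR : (0 : ℝ) < t := by exact_mod_cast ht
  have h₁ : ∑ a ∈ range m, ψ (2 * a + 1) ≤ S := by
    rw [← sum_image (f := ψ) (g := fun a => 2 * a + 1) (by intro a _ b _ h; simpa using h)]
    refine sum_le_sum_of_subset_of_nonneg ?_ fun _ _ _ => hψ _
    intro s hs
    simp only [mem_image, mem_range, mem_Icc] at hs ⊢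
    omega
  have h₂ : ∑ a ∈ range m, φ a ≤ 4 * S := by
    obtain ⟨m', rfl⟩ : ∃ m', m = m' + 1 := ⟨m - 1, by omega⟩
    rw [sum_range_succ', hφ₀, add_zero, hS, mul_sum]
    refine (sum_le_sum fun a _ => hφ (a + 1)).trans ?_
    rw [← sum_image (f := fun s => 4 * ψ s) (g := fun a => a + 1)
      (by intro a _ b _ h; simpa using h)]
    refine sum_le_sum_of_subset_of_nonneg ?_ fun _ _ _ => mul_nonneg (by norm_num) (hψ _)
    intro s hs
    simp only [mem_image, mem_range, mem_Icc] at hs ⊢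
    omega
  have h₃ : (t / 2 : ℝ) * ∑ a ∈ range m, e (2 * a) ≤ S := by
    have hs (s) (hs : s ∈ Icc (2 * m - 1) t) : ∑ a ∈ range m, e (2 * a) ≤ ψ s := by
      refine le_trans ?_ (hes s)
      rw [← sum_image (f := e) (g := fun a => 2 * a) (by intro a _ b _ h; simpa using h)]
      refine sum_le_sum_of_subset_of_nonneg ?_ fun _ _ _ => he _
      intro r hr
      simp only [mem_image, mem_range, mem_Icc] at hs hr ⊢
      omega
    have h := card_nsmul_le_sum _ _ _ hs
    have hc : (t : ℝ) / 2 ≤ ((Icc (2 * m - 1) t).card : ℝ) := by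
      rw [div_le_iff₀ two_pos, Nat.card_Icc]
      exact_mod_cast (by omega : t ≤ (t + 1 - (2 * m - 1)) * 2)
    rw [nsmul_eq_mul] at h
    refine ((mul_le_mul_of_nonneg_right hc (sum_nonneg fun _ _ => he _)).trans h).trans ?_
    exact sum_le_sum_of_subset_of_nonneg (Icc_subset_Icc_left (by omega)) fun _ _ _ => hψ _
  have h₄ : (m : ℝ) * T ≤ K * (∑ a ∈ range m, ψ (2 * a + 1) + ∑ a ∈ range m, φ a) +
      L * ∑ a ∈ range m, e (2 * a) := by
    have h := sum_le_sum fun a (_ : a ∈ range m) => hT a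
    simpa only [sum_const, card_range, nsmul_eq_mul, sum_add_distrib, ← mul_sum] using h
  have h₅ : (t : ℝ) / 4 * T ≤ m * T := by
    refine mul_le_mul_of_nonneg_right ?_ hT₀
    rw [div_le_iff₀ four_pos]
    exact_mod_cast (by omega : t ≤ m * 4)
  have h₆ : ∑ a ∈ range m, e (2 * a) ≤ 2 * (S / t) := by
    rw [mul_div_assoc', le_div_iff₀ htR]
    linarith
  have h₇ : (t : ℝ) / 4 * T ≤ K * (5 * S) + L * (2 * (S / t)) :=
    (h₅.trans h₄).trans (add_le_add (mul_le_mul_of_nonneg_left (by linarith) hK)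
      (mul_le_mul_of_nonneg_left h₆ hL))
  refine le_of_mul_le_mul_left (h₇.trans_eq ?_) (show (0 : ℝ) < t / 4 by positivity)
  field_simp
  ring

/-! ### Spectral gaps -/

/-- The infimum defining a finite `gammaPlus A X 2` is attained, up to positivity. -/
theorem sum_sq_dist_le_of_gammaPlus {n : ℕ} (hn : 1 ≤ n) {A : Matrix (Fin n) (Fin n) ℝ}
    (hA : ∀ i j, 0 ≤ A i j) {X : Type*} [MetricSpace X] (h : gammaPlus A X 2 ≠ ⊤)
    (x y : Fin n → X) :
    ∑ i, ∑ j, dist (x i) (y j) ^ 2 ≤ (gammaPlus A X 2).toReal * n * sqEnergy A x y := by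
  have hnR : (0 : ℝ) < n := by exact_mod_cast hn
  have hn0 : (n : ℝ≥0∞) ≠ 0 := by exact_mod_cast (by omega : n ≠ 0)
  have key : ENNReal.ofReal (1 / (n : ℝ) ^ 2 * ∑ i, ∑ j, dist (x i) (y j) ^ 2) ≤
      gammaPlus A X 2 * (ENNReal.ofReal (sqEnergy A x y) / n) := by
    have hmem : ∀ γ ∈ {γ : ℝ≥0∞ | 0 < γ ∧ ∀ x y : Fin n → X,
        ENNReal.ofReal (1 / (n : ℝ) ^ 2 * ∑ i, ∑ j, dist (x i) (y j) ^ (2 : ℝ)) ≤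
          γ / n * ENNReal.ofReal (∑ i, ∑ j, A i j * dist (x i) (y j) ^ (2 : ℝ))},
        ENNReal.ofReal (1 / (n : ℝ) ^ 2 * ∑ i, ∑ j, dist (x i) (y j) ^ 2) ≤
          γ * (ENNReal.ofReal (sqEnergy A x y) / n) := by
      rintro γ ⟨-, hγ⟩
      have := hγ x y
      simp only [Real.rpow_two] at this
      refine this.trans_eq ?_
      rw [sqEnergy, div_eq_mul_inv, div_eq_mul_inv, mul_assoc, mul_comm (ENNReal.ofReal _)]
    -- If the energy vanishes, division by it is meaningless, but any admissible `γ`, even `⊤`,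
    -- then forces the left-hand side to vanish.
    by_cases hc : ENNReal.ofReal (sqEnergy A x y) / n = 0
    · obtain ⟨γ, hγ, -⟩ := sInf_lt_iff.1 (lt_top_iff_ne_top.2 h)
      have := hmem γ hγ
      simpa [hc] using this
    · have hc' : ENNReal.ofReal (sqEnergy A x y) / n ≠ ⊤ :=
        ENNReal.div_ne_top ENNReal.ofReal_ne_top hn0
      rw [← ENNReal.div_le_iff hc hc']
      exact le_sInf fun γ hγ => (ENNReal.div_le_iff hc hc').2 (hmem γ hγ)
  have h' := ENNReal.toReal_mono
    (ENNReal.mul_ne_top h (ENNReal.div_ne_top ENNReal.ofReal_ne_top hn0)) key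
  rw [ENNReal.toReal_ofReal (by positivity), ENNReal.toReal_mul, ENNReal.toReal_div,
    ENNReal.toReal_ofReal (sqEnergy_nonneg hA x y), ENNReal.toReal_natCast] at h'
  have := mul_le_mul_of_nonneg_left h' (sq_nonneg (n : ℝ))
  field_simp at this
  linarith

theorem gammaPlus_le_ofReal {n : ℕ} (hn : 1 ≤ n) {A : Matrix (Fin n) (Fin n) ℝ}
    {X : Type*} [MetricSpace X] {c : ℝ} (hc : 0 < c)
    (h : ∀ x y : Fin n → X, ∑ i, ∑ j, dist (x i) (y j) ^ 2 ≤ c * n * sqEnergy A x y) :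
    gammaPlus A X 2 ≤ ENNReal.ofReal c := by
  have hnR : (0 : ℝ) < n := by exact_mod_cast hn
  refine sInf_le ⟨ENNReal.ofReal_pos.2 hc, fun x y => ?_⟩
  simp only [Real.rpow_two]
  rw [← ENNReal.ofReal_natCast n, ← ENNReal.ofReal_div_of_pos hnR,
    ← ENNReal.ofReal_mul (by positivity)]
  refine ENNReal.ofReal_le_ofReal ?_
  have := h x y
  rw [sqEnergy] at this
  refine (mul_le_mul_of_nonneg_left this (by positivity)).trans_eq ?_
  field_simp

theorem sqEnergy_cesaroAverage {n : ℕ} (A : Matrix (Fin n) (Fin n) ℝ) (t : ℕ) {X : Type*}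
    [MetricSpace X] (x y : Fin n → X) :
    sqEnergy (cesaroAverage A t) x y = 1 / t * ∑ s ∈ Icc 1 t, sqEnergy (A ^ s) x y := by
  simp only [sqEnergy, cesaroAverage, Matrix.smul_apply, Matrix.sum_apply, smul_eq_mul, mul_assoc,
    sum_mul, ← mul_sum]
  rw [sum_comm]
  congr 1
  rw [sum_comm, sum_comm (s := Icc 1 t)]
  exact sum_congr rfl fun i _ => sum_comm

/-- Quantitative core: a Poincaré inequality for `A` passes to its Cesàro averages. The comparison
configurations are consecutive iterates of the averaging operator started at `y`: the odd iterates
are close to `x`, the even ones to `y`. -/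
theorem IsCAT0.sum_sq_dist_le_cesaroAverage {X : Type*} [MetricSpace X] (hX : IsCAT0 X) {n t : ℕ}
    (hn : 1 ≤ n) (ht : 1 ≤ t) {A : Matrix (Fin n) (Fin n) ℝ}
    (hA : A ∈ Matrix.rowStochastic ℝ (Fin n)) (hAs : A.IsSymm) {g : ℝ} (hg : 0 ≤ g)
    (hgap : ∀ x y : Fin n → X, ∑ i, ∑ j, dist (x i) (y j) ^ 2 ≤ g * n * sqEnergy A x y)
    (x y : Fin n → X) :
    ∑ i, ∑ j, dist (x i) (y j) ^ 2 ≤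
      84 * max 1 (g / t) * n * sqEnergy (cesaroAverage A t) x y := by
  have : Nonempty X := ⟨x ⟨0, hn⟩⟩
  have hA₀ (i j) : 0 ≤ A i j := Matrix.nonneg_of_mem_rowStochastic hA
  have hpow (s : ℕ) : A ^ s ∈ Matrix.rowStochastic ℝ (Fin n) := pow_mem hA s
  have hAc : A ∈ Matrix.colStochastic ℝ (Fin n) := by
    rw [← Matrix.transpose_mem_rowStochastic_iff_mem_colStochastic, hAs.eq]
    exact hA
  -- By density, the Poincaré inequality extends to the completion.
  have hgap' (u v : Fin n → Completion X) :
      ∑ i, ∑ j, dist (u i) (v j) ^ 2 ≤ g * n * sqEnergy A u v := by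
    have hd : DenseRange (Pi.map fun (_ : Fin n) (a : X) => (a : Completion X)) :=
      DenseRange.piMap fun _ => Completion.denseRange_coe
    have hcl : IsClosed {q : (Fin n → Completion X) × (Fin n → Completion X) |
        ∑ i, ∑ j, dist (q.1 i) (q.2 j) ^ 2 ≤ g * n * sqEnergy A q.1 q.2} :=
      isClosed_le (by fun_prop) (by unfold sqEnergy; fun_prop)
    refine (hd.prodMap hd).induction_on (p := fun q : (Fin n → Completion X) × _ =>
      ∑ i, ∑ j, dist (q.1 i) (q.2 j) ^ 2 ≤ g * n * sqEnergy A q.1 q.2) (u, v) hcl ?_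
    rintro ⟨a, b⟩
    simpa [sqEnergy, Completion.dist_eq] using hgap a b
  have hbary (f : Fin n → Completion X) (i : Fin n) := hX.exists_barycenter (w := A i)
    (fun j => hA₀ i j) (Matrix.sum_row_of_mem_rowStochastic hA i) f
  choose P hP using hbary
  have hiter (z f : Fin n → Completion X) (s : ℕ) :=
    sqEnergy_iterate hAc hP z f s (one_mem (Matrix.colStochastic ℝ (Fin n)))
  simp only [one_mul, sqEnergy_one] at hiter
  let x' : Fin n → Completion X := fun i => x i
  let y' : Fin n → Completion X := fun i => y i
  have hcoe (M : Matrix (Fin n) (Fin n) ℝ) : sqEnergy M x' y' = sqEnergy M x y := by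
    simp [sqEnergy, x', y', Completion.dist_eq]
  have hesum (s : ℕ) : 0 ≤ ∑ r ∈ range s, sqEnergy A (P^[r + 1] y') (P^[r] y') :=
    sum_nonneg fun r _ => sqEnergy_nonneg hA₀ _ _
  have hT := le_of_forall_dissipation (t := t) ht (T := ∑ i, ∑ j, dist (x i) (y j) ^ 2)
    (K := 3 * n) (L := 3 * (g * n)) (by positivity) (by positivity)
    (ψ := fun s => sqEnergy (A ^ s) x y) (φ := fun a => ∑ j, dist (y' j) (P^[2 * a] y' j) ^ 2)
    (e := fun r => sqEnergy A (P^[r + 1] y') (P^[r] y'))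
    (fun s => sqEnergy_nonneg (fun _ _ => Matrix.nonneg_of_mem_rowStochastic (hpow s)) x y)
    (fun r => sqEnergy_nonneg hA₀ _ _)
    (by positivity)
    (fun a => by
      have h₁ := sum_sq_dist_le_of_approx x' y' (P^[2 * a + 1] y') (P^[2 * a] y')
      have h₂ := hgap' (P^[2 * a + 1] y') (P^[2 * a] y')
      have h₃ := hiter x' y' (2 * a + 1)
      have h₄ := hesum (2 * a + 1)
      rw [hcoe] at h₃
      have h₅ : ∑ i, dist (x' i) (P^[2 * a + 1] y' i) ^ 2 ≤ sqEnergy (A ^ (2 * a + 1)) x y := by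
        linarith
      have h₆ := mul_le_mul_of_nonneg_left h₅ (Nat.cast_nonneg (α := ℝ) n)
      simp only [x', y', Completion.dist_eq, Fintype.card_fin] at h₁ h₂ h₆ ⊢
      linarith)
    (fun s => by
      have h := hiter x' y' s
      rw [hcoe] at h
      have : 0 ≤ ∑ i, dist (x' i) (P^[s] y' i) ^ 2 := by positivity
      linarith)
    (by simp)
    (fun a => by
      have h := hiter y' y' (2 * a)
      have h₁ := hesum (2 * a)
      have h₂ := sqEnergy_mul_self_le (hpow a) (hAs.pow a) x' y'
      rw [hcoe, ← pow_add, ← two_mul] at h₂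
      linarith)
  rw [← sqEnergy_cesaroAverage] at hT
  refine hT.trans (mul_le_mul_of_nonneg_right ?_ ?_)
  · have h₁ := mul_le_mul_of_nonneg_right (le_max_left 1 (g / t)) (Nat.cast_nonneg (α := ℝ) n)
    have h₂ := mul_le_mul_of_nonneg_right (le_max_right 1 (g / t)) (Nat.cast_nonneg (α := ℝ) n)
    have h₃ : 3 * (g * n) / t = 3 * (g / t * n) := by ring
    rw [h₃]
    linarith
  · rw [sqEnergy_cesaroAverage]
    exact mul_nonneg (by positivity) (sum_nonneg fun s _ =>
      sqEnergy_nonneg (fun _ _ => Matrix.nonneg_of_mem_rowStochastic (hpow s)) x y)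

theorem corollary1p6 :
    ∃ C : ℝ, 0 < C ∧ ∀ (X : Type*) [MetricSpace X], IsCAT0 X →
      ∀ n t : ℕ, 1 ≤ n → 1 ≤ t → ∀ A : Matrix (Fin n) (Fin n) ℝ,
        A ∈ Matrix.rowStochastic ℝ (Fin n) → A.IsSymm →
        gammaPlus (cesaroAverage A t) X 2 ≤
          ENNReal.ofReal C * max 1 (gammaPlus A X 2 / (t : ℝ≥0∞)) := by
  -- `84 = 60 + 24`: the distance errors cost `60`, the dissipated energies cost `24 g / t`.
  refine ⟨84, by norm_num, fun X _ hX n t hn ht A hA hAs => ?_⟩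
  have htR : (0 : ℝ) < t := by exact_mod_cast ht
  by_cases h : gammaPlus A X 2 = ⊤
  · rw [h, ENNReal.top_div_of_ne_top (ENNReal.natCast_ne_top t), max_eq_right le_top,
      ENNReal.mul_top (by simp)]
    exact le_top
  · have hfin := gammaPlus_le_ofReal hn (A := cesaroAverage A t) (X := X)
      (c := 84 * max 1 ((gammaPlus A X 2).toReal / t)) (by positivity)
      (hX.sum_sq_dist_le_cesaroAverage hn ht hA hAs ENNReal.toReal_nonneg
        (sum_sq_dist_le_of_gammaPlus hn
          (fun _ _ => Matrix.nonneg_of_mem_rowStochastic hA) h))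
    rwa [ENNReal.ofReal_mul (by norm_num), ENNReal.ofReal_max, ENNReal.ofReal_one,
      ENNReal.ofReal_div_of_pos htR, ENNReal.ofReal_toReal h, ENNReal.ofReal_natCast] at hfin
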